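/- Let $D\in\mathbb{R}^{n\times N}$ be a tight frame in the sense that $DD^*=I_n$, let $s>0$ be a real number, and let $$\mathcal{K}_s=\{f\in\mathbb{R}^n:\ \|f\|_2=1,\ \|D^*f\|_1\le\sqrt{s}\,\|D^*f\|_2\}$$ be the set of $\ell_2$-normalized effectively $s$-analysis-sparse signals. For $K\subseteq\mathbb{R}^n$ let $w(K)=\mathbb{E}\big[\sup_{f\in K}\langle f,g\rangle\big]$, where $g\in\mathbb{R}^n$ is a standard normal random vector, be its Gaussian width (with $\sup\emptyset=0$), and for $\rho>0$ let $\mathcal{N}(K,\rho)$ be its covering number, i.e. the smallest number of closed Euclidean balls of radius $\rho$ with centers in $K$ that cover $K$. Then there is an absolute constant $C>0$ (independent of $n$, $N$, $D$, $s$) such that: (i) if $s\le N$, then $g\mapsto\sup_{f\in\mathcal{K}_s}\langle f,g\rangle$ is integrable and $$w(\mathcal{K}_s)\le C\sqrt{s\ln(eN/s)};$$ (ii) for every $\rho>0$ such that $t:=\lceil 4\rho^{-2}s\rceil$ satisfies $t\le N$, $$\mathcal{N}(\mathcal{K}_s,\rho)\le\binom{N}{t}\left(1+\frac{8}{\rho}\right)^t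 .$$ -/

import Mathlib

open MeasureTheory ProbabilityTheory
open scoped NNReal ENNReal Matrix

noncomputable section

/-- A real `n × N` dictionary is a (Parseval) tight frame when `D D* = I_n`. -/
def IsTightFrame {n N : ℕ} (D : Matrix (Fin n) (Fin N) ℝ) : Prop :=
  D * Dᵀ = 1

/-- The effectively `s`-sparse coefficient vectors of `ℝ^N`: `‖x‖₁ ≤ √s ‖x‖₂`. -/
def effSparse (N : ℕ) (s : ℝ) : Set (EuclideanSpace ℝ (Fin N)) :=
  {x | ∑ i, |x i| ≤ √s * ‖x‖}

/-- The effectively `s`-analysis-sparse signals: the preimage of `effSparse N s` under `D*`. -/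
def effAnalysisSparse {n N : ℕ} (D : Matrix (Fin n) (Fin N) ℝ) (s : ℝ) :
    Set (EuclideanSpace ℝ (Fin n)) :=
  (fun f => Matrix.toEuclideanLin Dᵀ f) ⁻¹' effSparse N s

/-- The `ℓ₂`-normalized effectively `s`-analysis-sparse signals. -/
def unitEffAnalysisSparse {n N : ℕ} (D : Matrix (Fin n) (Fin N) ℝ) (s : ℝ) :
    Set (EuclideanSpace ℝ (Fin n)) :=
  effAnalysisSparse D s ∩ Metric.sphere 0 1

/-- `sup_{f ∈ K} ⟨f, g⟩`, equal to `0` when `K` is empty. -/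
def supInner {n : ℕ} (K : Set (EuclideanSpace ℝ (Fin n))) (g : EuclideanSpace ℝ (Fin n)) : ℝ :=
  sSup ((fun f => inner ℝ f g) '' K)

/-- The Gaussian width `w(K) = 𝔼 sup_{f ∈ K} ⟨f, g⟩`, for a standard normal vector `g` in `ℝ^n`. -/
def gaussianWidth {n : ℕ} (K : Set (EuclideanSpace ℝ (Fin n))) : ℝ :=
  ∫ g, supInner K g ∂(stdGaussian (EuclideanSpace ℝ (Fin n)))

end

/-! Since `D * Dᵀ = 1`, analysis f ↦ D*f is an isometry with left inverse the contraction D. So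
signals may be replaced by coefficient vectors x = D*f with ‖x‖₂ = 1 and ‖x‖₁ ≤ √s.

Covering: Stechkin's estimate makes x close to its t largest entries, with squared tail at most
s/(4t) ≤ (ρ/4)². Volumetric (ρ/4)-nets of the unit balls of all t-dimensional coordinate subspaces,
pushed forward by D, then form a (ρ/2)-cover; moving its centres into the set doubles the radius.

Width: ⟨f, g⟩ = ⟨x, h⟩ with h = D*g, whose coordinates are Gaussian of variance at most 1. Cut |hᵢ|
at level l: the part below costs at most l‖x‖₁ ≤ l√s, and the excess is handled by a weighted AM-GM
and exponential moments. Taking l² = 2 ln(eN/s) balances the two. Neither chaining nor independence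
of the hᵢ is needed. -/

/-! ### Volumetric nets of the unit ball -/

section Covering

variable {E : Type*} [NormedAddCommGroup E] [NormedSpace ℝ E] [FiniteDimensional ℝ E]

/-- Volume bound for `ε`-separated subsets of the unit ball. -/
theorem card_le_of_separated_unitBall {ε : ℝ} (hε : 0 < ε) (s : Finset E)
    (hs : ∀ c ∈ s, ‖c‖ ≤ 1) (h : ∀ c ∈ s, ∀ d ∈ s, c ≠ d → ε ≤ dist c d) :
    (s.card : ℝ) ≤ (1 + 2 / ε) ^ Module.finrank ℝ E := by
  borelize E
  let μ : Measure E := Measure.addHaar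
  have hδ : 0 < ε / 2 := by positivity
  have hR : 0 < 1 + ε / 2 := by positivity
  have hdisj : Set.Pairwise (s : Set E)
      (Function.onFun Disjoint fun c => Metric.ball (c : E) (ε / 2)) := by
    rintro c hc d hd hcd
    apply Metric.ball_disjoint_ball
    rw [add_halves]
    exact h c hc d hd hcd
  have hsub : (⋃ c ∈ s, Metric.ball (c : E) (ε / 2)) ⊆ Metric.ball (0 : E) (1 + ε / 2) := by
    refine Set.iUnion₂_subset fun x hx => Metric.ball_subset_ball' ?_
    rw [dist_zero_right]
    linarith [hs x hx]
  have hvol : (s.card : ℝ≥0∞) * ENNReal.ofReal ((ε / 2) ^ Module.finrank ℝ E)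
        * μ (Metric.ball 0 1)
      ≤ ENNReal.ofReal ((1 + ε / 2) ^ Module.finrank ℝ E) * μ (Metric.ball 0 1) := by
    have hle := measure_mono (μ := μ) hsub
    rw [measure_biUnion_finset hdisj fun c _ => measurableSet_ball,
      μ.addHaar_ball_of_pos _ hR] at hle
    simpa only [μ.addHaar_ball_of_pos _ hδ, Finset.sum_const, nsmul_eq_mul, mul_assoc] using hle
  have hcard := ENNReal.toReal_le_of_le_ofReal (by positivity)
    ((ENNReal.mul_le_mul_iff_left (Metric.measure_ball_pos _ _ zero_lt_one).ne'
      measure_ball_lt_top.ne).1 hvol)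
  rw [ENNReal.toReal_mul, ENNReal.toReal_natCast, ENNReal.toReal_ofReal (by positivity)] at hcard
  have hratio : 1 + 2 / ε = (1 + ε / 2) / (ε / 2) := by field_simp; ring
  rw [hratio, div_pow, le_div_iff₀ (by positivity)]
  exact hcard

/-- The unit ball of a `d`-dimensional space has an `ε`-cover of at most `(1 + 2 / ε) ^ d`
points. -/
theorem exists_finset_isCover_unitBall {ε : ℝ≥0} (hε : 0 < ε) :
    ∃ C : Finset E, Metric.IsCover ε (Metric.closedBall (0 : E) 1) (C : Set E) ∧
      (C.card : ℝ) ≤ (1 + 2 / (ε : ℝ)) ^ Module.finrank ℝ E := by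
  set M : ℝ := (1 + 2 / (ε : ℝ)) ^ Module.finrank ℝ E
  -- A maximal separated set is a net, so bounding the packing number suffices. A separated set may
  -- be infinite, hence the passage to a subset of exactly ⌊M⌋ + 1 points.
  have hpack : Metric.packingNumber ε (Metric.closedBall (0 : E) 1) ≤ (⌊M⌋₊ : ℕ∞) := by
    refine iSup₂_le fun C hC => iSup_le fun hsep => ?_
    by_contra! hlt
    obtain ⟨T, hTC, hT⟩ := Set.exists_subset_encard_eq
      (show ((⌊M⌋₊ + 1 : ℕ) : ℕ∞) ≤ C.encard by
        push_cast
        exact Order.add_one_le_of_lt hlt)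
    have hfin : T.Finite := Set.finite_of_encard_eq_coe hT
    lift T to Finset E using hfin
    rw [Set.encard_coe_eq_coe_finsetCard, Nat.cast_inj] at hT
    have hle := card_le_of_separated_unitBall (E := E) (NNReal.coe_pos.2 hε) T
      (fun c hc => by simpa using hC (hTC hc))
      (fun c hc d hd hcd => by
        have hcd' : (ε : ℝ≥0∞) < edist c d := hsep (hTC hc) (hTC hd) hcd
        rw [edist_nndist, ENNReal.coe_lt_coe] at hcd'
        exact_mod_cast hcd'.le)
    rw [hT] at hle
    exact absurd hle (not_le.2 (by exact_mod_cast Nat.lt_floor_add_one M))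
  have hcov := (Metric.coveringNumber_le_packingNumber ε (Metric.closedBall (0 : E) 1)).trans hpack
  obtain ⟨C, -, hCfin, hC, hcard⟩ := Metric.exists_set_encard_eq_coveringNumber
    (ne_top_of_le_ne_top (ENat.natCast_ne_top _) hcov)
  lift C to Finset E using hCfin
  refine ⟨C, hC, ?_⟩
  rw [← hcard, Set.encard_coe_eq_coe_finsetCard, Nat.cast_le] at hcov
  exact (Nat.cast_le.2 hcov).trans (Nat.floor_le (by positivity))

end Covering

/-! ### Best t-term approximation -/

section BestTermApproximation

variable {ι : Type*} [Fintype ι] [DecidableEq ι]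

theorem exists_card_eq_forall_le_of_notMem (a : ι → ℝ) {t : ℕ} (ht : t ≤ Fintype.card ι) :
    ∃ S : Finset ι, S.card = t ∧ ∀ i ∈ S, ∀ j ∉ S, a j ≤ a i := by
  induction t with
  | zero => exact ⟨∅, by simp⟩
  | succ t ih =>
    obtain ⟨S, hS, hle⟩ := ih (by omega)
    have hne : (Sᶜ).Nonempty := by
      rw [← Finset.card_pos, Finset.card_compl]
      omega
    obtain ⟨k, hk, hmax⟩ := Finset.exists_max_image Sᶜ a hne
    rw [Finset.mem_compl] at hk
    refine ⟨insert k S, by rw [Finset.card_insert_of_notMem hk, hS], fun i hi j hj => ?_⟩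
    rw [Finset.mem_insert, not_or] at hj
    rcases Finset.mem_insert.1 hi with rfl | hi
    · exact hmax j (Finset.mem_compl.2 hj.2)
    · exact hle i hi j hj.2

/-- Stechkin's estimate, with the sharp constant `1 / 2`, for the best `t`-term approximation. -/
theorem exists_card_eq_sum_compl_sq_le (x : ι → ℝ) {t : ℕ} (ht : t ≤ Fintype.card ι) :
    ∃ S : Finset ι, S.card = t ∧ 4 * t * ∑ i ∈ Sᶜ, x i ^ 2 ≤ (∑ i, |x i|) ^ 2 := by
  obtain ⟨S, hS, hle⟩ := exists_card_eq_forall_le_of_notMem (fun i => |x i|) ht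
  refine ⟨S, hS, ?_⟩
  set P := ∑ i ∈ S, |x i|
  set Q := ∑ i ∈ Sᶜ, |x i|
  have hsum : ∑ i, |x i| = P + Q := (Finset.sum_add_sum_compl S _).symm
  -- Every entry outside `S` is at most the average P/t of the entries inside.
  have hPQ : (t : ℝ) * ∑ i ∈ Sᶜ, x i ^ 2 ≤ P * Q := by
    rw [Finset.mul_sum, Finset.mul_sum]
    refine Finset.sum_le_sum fun j hj => ?_
    have hj' : (t : ℝ) * |x j| ≤ P := by
      rw [← hS, ← nsmul_eq_mul]
      exact Finset.card_nsmul_le_sum _ _ _ fun i hi => hle i hi j (Finset.mem_compl.1 hj)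
    rw [← sq_abs, sq, ← mul_assoc]
    exact mul_le_mul_of_nonneg_right hj' (abs_nonneg _)
  rw [hsum]
  -- The constant 4 is that of 4PQ ≤ (P + Q)².
  nlinarith [sq_nonneg (P - Q)]

end BestTermApproximation

/-! ### Analysis is isometric, synthesis is contractive -/

section TightFrame

variable {n N : ℕ} {D : Matrix (Fin n) (Fin N) ℝ}

theorem inner_toEuclideanLin_transpose (D : Matrix (Fin n) (Fin N) ℝ)
    (f : EuclideanSpace ℝ (Fin n)) (x : EuclideanSpace ℝ (Fin N)) :
    inner ℝ (Matrix.toEuclideanLin Dᵀ f) x = inner ℝ f (Matrix.toEuclideanLin D x) := by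
  rw [← Matrix.conjTranspose_eq_transpose_of_trivial, Matrix.toEuclideanLin_conjTranspose_eq_adjoint,
    LinearMap.adjoint_inner_left]

namespace IsTightFrame

theorem synthesis_analysis (hD : IsTightFrame D) (f : EuclideanSpace ℝ (Fin n)) :
    Matrix.toEuclideanLin D (Matrix.toEuclideanLin Dᵀ f) = f := by
  have hD' : D * Dᵀ = 1 := hD
  ext i
  simp [Matrix.toLpLin_apply, Matrix.mulVec_mulVec, hD']

theorem inner_analysis (hD : IsTightFrame D) (f g : EuclideanSpace ℝ (Fin n)) :
    inner ℝ (Matrix.toEuclideanLin Dᵀ f) (Matrix.toEuclideanLin Dᵀ g) = inner ℝ f g := by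
  rw [inner_toEuclideanLin_transpose, hD.synthesis_analysis]

theorem norm_analysis (hD : IsTightFrame D) (f : EuclideanSpace ℝ (Fin n)) :
    ‖Matrix.toEuclideanLin Dᵀ f‖ = ‖f‖ := by
  rw [@norm_eq_sqrt_real_inner _ _ _ (Matrix.toEuclideanLin Dᵀ f), hD.inner_analysis,
    ← norm_eq_sqrt_real_inner]

/-- Synthesis is the adjoint of an isometry: ‖y‖² = ⟨D*y, x⟩ ≤ ‖y‖ ‖x‖ for y = Dx. -/
theorem norm_synthesis_le (hD : IsTightFrame D) (x : EuclideanSpace ℝ (Fin N)) :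
    ‖Matrix.toEuclideanLin D x‖ ≤ ‖x‖ := by
  set y := Matrix.toEuclideanLin D x
  have h : ‖y‖ * ‖y‖ ≤ ‖y‖ * ‖x‖ := by
    rw [← real_inner_self_eq_norm_mul_norm, ← inner_toEuclideanLin_transpose]
    exact (real_inner_le_norm _ _).trans_eq (by rw [hD.norm_analysis])
  rcases (norm_nonneg y).eq_or_lt with h0 | h0
  · rw [← h0]
    positivity
  · exact le_of_mul_le_mul_left h h0

end IsTightFrame

theorem mem_unitEffAnalysisSparse_iff {s : ℝ} (hD : IsTightFrame D)
    {f : EuclideanSpace ℝ (Fin n)} :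
    f ∈ unitEffAnalysisSparse D s ↔
      ∑ i, |Matrix.toEuclideanLin Dᵀ f i| ≤ √s ∧ ‖f‖ = 1 := by
  simp only [unitEffAnalysisSparse, effAnalysisSparse, effSparse, Set.mem_inter_iff,
    Set.mem_preimage, Set.mem_ofPred_eq, mem_sphere_zero_iff_norm, hD.norm_analysis]
  exact and_congr_left fun h => by rw [h, mul_one]

end TightFrame

/-! ### Covering number bound -/

section CoveringNumber

/-- Extension by zero of a vector supported on a finite set of coordinates. -/
noncomputable def extendByZero {ι : Type*} [DecidableEq ι] (S : Finset ι)
    (y : EuclideanSpace ℝ S) : EuclideanSpace ℝ ι :=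
  WithLp.toLp 2 fun i => if h : i ∈ S then y ⟨i, h⟩ else 0

/-- Pythagoras separates the net error on `S` from the truncation error off `S`. -/
theorem norm_sub_extendByZero_sq {ι : Type*} [Fintype ι] [DecidableEq ι] (S : Finset ι)
    (x : EuclideanSpace ℝ ι) (y : EuclideanSpace ℝ S) :
    ‖x - extendByZero S y‖ ^ 2 =
      ‖WithLp.toLp 2 (fun i : S => x i) - y‖ ^ 2 + ∑ i ∈ Sᶜ, x i ^ 2 := by
  rw [EuclideanSpace.real_norm_sq_eq, EuclideanSpace.real_norm_sq_eq,
    ← Finset.sum_add_sum_compl S]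
  congr 1
  · rw [← Finset.sum_coe_sort]
    exact Finset.sum_congr rfl fun i _ => by simp [extendByZero]
  · refine Finset.sum_congr rfl fun i hi => ?_
    simp [extendByZero, Finset.mem_compl.1 hi]

variable {n N : ℕ} {D : Matrix (Fin n) (Fin N) ℝ}

theorem exists_finset_isCover_unitEffAnalysisSparse (hD : IsTightFrame D) {s : ℝ} (hs : 0 < s)
    {ρ : ℝ≥0} (hρ : 0 < ρ) {t : ℕ} (hst : 4 * ((ρ : ℝ) ^ 2)⁻¹ * s ≤ t) (htN : t ≤ N) :
    ∃ T : Finset (EuclideanSpace ℝ (Fin n)),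
      Metric.IsCover (ρ / 2) (unitEffAnalysisSparse D s) (T : Set _) ∧
      (T.card : ℝ) ≤ N.choose t * (1 + 8 / (ρ : ℝ)) ^ t := by
  classical
  have hρ0 : (0 : ℝ) < ρ := hρ
  have hρ4 : 0 < ρ / 4 := by positivity
  choose C hC hCcard using fun S : Finset (Fin N) =>
    exists_finset_isCover_unitBall (E := EuclideanSpace ℝ S) hρ4
  refine ⟨(Finset.powersetCard t Finset.univ).biUnion fun S =>
    (C S).image fun y => Matrix.toEuclideanLin D (extendByZero S y), fun f hf => ?_, ?_⟩
  · obtain ⟨hl1, hl2⟩ := (mem_unitEffAnalysisSparse_iff hD).1 hf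
    set x := Matrix.toEuclideanLin Dᵀ f with hx
    obtain ⟨S, hS, htail⟩ := exists_card_eq_sum_compl_sq_le x
      (show t ≤ Fintype.card (Fin N) by simpa using htN)
    have htail' : ∑ i ∈ Sᶜ, x i ^ 2 ≤ ((ρ : ℝ) / 4) ^ 2 := by
      have hl1sq : (∑ i, |x i|) ^ 2 ≤ s := by
        rw [← Real.sq_sqrt hs.le]
        gcongr
      have hst' : 4 * s ≤ t * (ρ : ℝ) ^ 2 := by
        have h := mul_le_mul_of_nonneg_right hst (sq_nonneg (ρ : ℝ))
        rwa [show 4 * ((ρ : ℝ) ^ 2)⁻¹ * s * (ρ : ℝ) ^ 2 = 4 * s by field_simp] at h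
      have ht : (0 : ℝ) < t := lt_of_lt_of_le (by positivity) hst
      refine le_of_mul_le_mul_left (a := 4 * (t : ℝ)) ?_ (by positivity)
      nlinarith
    have hxS : WithLp.toLp 2 (fun i : S => x i) ∈
        Metric.closedBall (0 : EuclideanSpace ℝ S) 1 := by
      rw [mem_closedBall_zero_iff, ← sq_le_one_iff₀ (norm_nonneg _)]
      have hxnorm : ‖x‖ ^ 2 = 1 := by rw [hx, hD.norm_analysis, hl2, one_pow]
      rw [EuclideanSpace.real_norm_sq_eq] at hxnorm ⊢
      rw [← hxnorm, ← Finset.sum_add_sum_compl S, ← Finset.sum_coe_sort S]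
      exact le_add_of_nonneg_right (Finset.sum_nonneg fun i _ => sq_nonneg _)
    obtain ⟨y, hy, hxy⟩ := hC S hxS
    refine ⟨Matrix.toEuclideanLin D (extendByZero S y), ?_, ?_⟩
    · exact Finset.mem_coe.2 (Finset.mem_biUnion.2
        ⟨S, Finset.mem_powersetCard_univ.2 hS, Finset.mem_image_of_mem _ hy⟩)
    · change edist _ _ ≤ ((ρ / 4 : ℝ≥0) : ℝ≥0∞) at hxy
      change edist _ _ ≤ ((ρ / 2 : ℝ≥0) : ℝ≥0∞)
      rw [edist_nndist, ENNReal.coe_le_coe, ← NNReal.coe_le_coe, coe_nndist, dist_eq_norm] at hxy ⊢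
      push_cast at hxy ⊢
      refine le_trans ?_ (abs_le_of_sq_le_sq' (a := ‖x - extendByZero S y‖) ?_ (by positivity)).2
      · calc ‖f - Matrix.toEuclideanLin D (extendByZero S y)‖
            = ‖Matrix.toEuclideanLin D (x - extendByZero S y)‖ := by
              rw [map_sub, hx, hD.synthesis_analysis]
          _ ≤ _ := hD.norm_synthesis_le _
      · rw [norm_sub_extendByZero_sq]
        -- Net error and tail are each at most ρ/4, so the squared distance is at most ρ²/8 ≤
        -- (ρ/2)².
        have hxy2 := pow_le_pow_left₀ (norm_nonneg _) hxy 2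
        nlinarith
  · have hbound : ∀ S ∈ Finset.powersetCard t (Finset.univ : Finset (Fin N)),
        (((C S).image fun y => Matrix.toEuclideanLin D (extendByZero S y)).card : ℝ) ≤
          (1 + 8 / (ρ : ℝ)) ^ t := fun S hS => by
      refine (Nat.cast_le.2 Finset.card_image_le).trans ((hCcard S).trans_eq ?_)
      rw [finrank_euclideanSpace, Fintype.card_coe, Finset.mem_powersetCard_univ.1 hS]
      congr 2
      push_cast
      field_simp
      norm_num
    calc _ ≤ ((∑ S ∈ Finset.powersetCard t (Finset.univ : Finset (Fin N)),
            ((C S).image fun y => Matrix.toEuclideanLin D (extendByZero S y)).card : ℕ) : ℝ) :=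
          Nat.cast_le.2 Finset.card_biUnion_le
      _ ≤ _ := by
          push_cast
          refine (Finset.sum_le_card_nsmul _ _ _ hbound).trans_eq ?_
          rw [Finset.card_powersetCard, Finset.card_univ, Fintype.card_fin, nsmul_eq_mul]

theorem coveringNumber_unitEffAnalysisSparse_le (hD : IsTightFrame D) {s : ℝ} (hs : 0 < s)
    {ρ : ℝ≥0} (hρ : 0 < ρ) {t : ℕ} (hst : 4 * ((ρ : ℝ) ^ 2)⁻¹ * s ≤ t) (htN : t ≤ N) :
    (Metric.coveringNumber ρ (unitEffAnalysisSparse D s) : ℝ≥0∞)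
      ≤ (N.choose t : ℝ≥0∞) * (1 + 8 / (ρ : ℝ≥0∞)) ^ t := by
  obtain ⟨T, hT, hcard⟩ := exists_finset_isCover_unitEffAnalysisSparse hD hs hρ hst htN
  have hcov : Metric.coveringNumber ρ (unitEffAnalysisSparse D s) ≤ (T.card : ℕ∞) := by
    -- The centres need not lie in the set; the factor 2 pays for recentring.
    have h := (Metric.coveringNumber_two_mul_le_externalCoveringNumber (ρ / 2)
      (unitEffAnalysisSparse D s)).trans hT.externalCoveringNumber_le_encard
    rwa [mul_div_cancel₀ _ two_ne_zero, Set.encard_coe_eq_coe_finsetCard] at h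
  calc (Metric.coveringNumber ρ (unitEffAnalysisSparse D s) : ℝ≥0∞)
      ≤ (T.card : ℝ≥0∞) := by simpa using ENat.toENNReal_le.2 hcov
    _ ≤ ((N.choose t * (1 + 8 / ρ) ^ t : ℝ≥0) : ℝ≥0∞) := by
        have h : (T.card : ℝ≥0) ≤ N.choose t * (1 + 8 / ρ) ^ t := by
          rw [← NNReal.coe_le_coe]
          push_cast
          exact hcard
        exact_mod_cast h
    _ = _ := by
        push_cast [ENNReal.coe_div hρ.ne']
        rfl

end CoveringNumber

/-! ### Regularity of the supremum -/

section SupInner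

variable {n : ℕ} {K : Set (EuclideanSpace ℝ (Fin n))}

theorem inner_le_norm_of_subset_closedBall (hK : K ⊆ Metric.closedBall 0 1)
    {f : EuclideanSpace ℝ (Fin n)} (hf : f ∈ K) (g : EuclideanSpace ℝ (Fin n)) :
    inner ℝ f g ≤ ‖g‖ :=
  (real_inner_le_norm f g).trans
    (mul_le_of_le_one_left (norm_nonneg g) (mem_closedBall_zero_iff.1 (hK hf)))

theorem lipschitzWith_supInner (hK : K ⊆ Metric.closedBall 0 1) :
    LipschitzWith 1 (supInner K) := by
  refine LipschitzWith.of_le_add fun g g' => ?_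
  rcases K.eq_empty_or_nonempty with rfl | hne
  · simp [supInner]
  refine csSup_le (hne.image _) ?_
  rintro _ ⟨f, hf, rfl⟩
  have hbdd : BddAbove ((fun f => inner ℝ f g') '' K) :=
    ⟨‖g'‖, by rintro _ ⟨f, hf, rfl⟩; exact inner_le_norm_of_subset_closedBall hK hf g'⟩
  have h1 : inner ℝ f g' ≤ supInner K g' := le_csSup hbdd ⟨f, hf, rfl⟩
  have h2 := inner_le_norm_of_subset_closedBall hK hf (g - g')
  rw [inner_sub_right] at h2
  rw [dist_eq_norm]
  linarith

theorem integrable_supInner (hK : K ⊆ Metric.closedBall 0 1) :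
    Integrable (supInner K) (stdGaussian (EuclideanSpace ℝ (Fin n))) := by
  have hlip := lipschitzWith_supInner hK
  have hzero : supInner K 0 = 0 := by
    rcases K.eq_empty_or_nonempty with rfl | hne
    · simp [supInner]
    · simp [supInner, hne.image_const]
  -- The Lipschitz bound gives both measurability and domination by ‖g‖, as the supremum vanishes at
  -- 0.
  refine (IsGaussian.integrable_fun_id
    (μ := stdGaussian (EuclideanSpace ℝ (Fin n)))).norm.mono'
    hlip.continuous.aestronglyMeasurable (Filter.Eventually.of_forall fun g => ?_)
  simpa [hzero] using hlip.dist_le_mul g 0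

end SupInner

/-! ### Exponential moments of Gaussian linear forms -/

section GaussianMGF

variable {n : ℕ} (a : EuclideanSpace ℝ (Fin n))

theorem map_inner_stdGaussian :
    (stdGaussian (EuclideanSpace ℝ (Fin n))).map (fun g => inner ℝ a g)
      = gaussianReal 0 (‖a‖ ^ 2).toNNReal := by
  have h := IsGaussian.map_eq_gaussianReal (μ := stdGaussian (EuclideanSpace ℝ (Fin n)))
    (innerSL ℝ a)
  rwa [integral_strongDual_stdGaussian, variance_dual_stdGaussian, innerSL_apply_norm] at h

theorem integrable_exp_mul_inner_stdGaussian (r : ℝ) :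
    Integrable (fun g => Real.exp (r * inner ℝ a g))
      (stdGaussian (EuclideanSpace ℝ (Fin n))) := by
  have h := integrable_exp_mul_gaussianReal (μ := 0) (v := (‖a‖ ^ 2).toNNReal) r
  rw [← map_inner_stdGaussian] at h
  exact h.comp_measurable (by fun_prop)

theorem integral_exp_mul_inner_stdGaussian (r : ℝ) :
    ∫ g, Real.exp (r * inner ℝ a g) ∂(stdGaussian (EuclideanSpace ℝ (Fin n)))
      = Real.exp (‖a‖ ^ 2 * r ^ 2 / 2) := by
  have h := mgf_gaussianReal (map_inner_stdGaussian a) r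
  rw [mgf, zero_mul, zero_add, Real.coe_toNNReal _ (by positivity)] at h
  exact h

end GaussianMGF

/-! ### Gaussian width bound -/

section GaussianWidth

/-- The squared excess of `|h|` over a threshold is dominated by exponentials of `h`. -/
theorem sq_excess_le_exp {l : ℝ} (hl : 2 ≤ l ^ 2) (hl0 : 0 ≤ l) (h : ℝ) :
    max (|h| - l) 0 ^ 2 ≤
      Real.exp (-l ^ 2) * (Real.exp (l * h) + Real.exp (-l * h)) := by
  set u := max (|h| - l) 0
  have hu : 0 ≤ u := le_max_right _ _
  have hexp : Real.exp (l * |h|) ≤ Real.exp (l * h) + Real.exp (-l * h) := by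
    rcases abs_choice h with h' | h' <;> rw [h']
    · linarith [Real.exp_pos (-l * h)]
    · rw [mul_neg, ← neg_mul]
      linarith [Real.exp_pos (l * h)]
  rcases le_total (|h| - l) 0 with hle | hle
  · have : u = 0 := max_eq_right hle
    rw [this, zero_pow two_ne_zero]
    positivity
  · have hueq : u = |h| - l := max_eq_left hle
    have hq := Real.quadratic_le_exp_of_nonneg (mul_nonneg hl0 hu)
    have hlu : 0 ≤ l * u := mul_nonneg hl0 hu
    -- Here 2 ≤ l² absorbs the 1/2 of the quadratic term of the exponential series.
    calc u ^ 2 ≤ (l * u) ^ 2 / 2 := by nlinarith [sq_nonneg u]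
      _ ≤ Real.exp (l * u) := by linarith
      _ = Real.exp (-l ^ 2) * Real.exp (l * |h|) := by
          rw [← Real.exp_add, hueq]
          ring_nf
      _ ≤ _ := by gcongr

/-- With uᵢ = (|hᵢ| − l)₊, one has |hᵢ| ≤ l + uᵢ, and |xᵢ|uᵢ ≤ (√s/2)xᵢ² + uᵢ²/(2√s). The weight √s
suits the later choice of l, for which the expected sum of the uᵢ² is at most s. -/
theorem inner_le_threshold {ι : Type*} [Fintype ι] {s l : ℝ} (hs : 0 < s) (hl : 2 ≤ l ^ 2)
    (hl0 : 0 ≤ l) (x h : EuclideanSpace ℝ ι) (hx1 : ∑ i, |x i| ≤ √s) (hx2 : ‖x‖ ≤ 1) :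
    inner ℝ x h ≤ √s * l + √s / 2 + (2 * √s)⁻¹ *
      ∑ i, Real.exp (-l ^ 2) * (Real.exp (l * h i) + Real.exp (-l * h i)) := by
  have hs' : 0 < √s := Real.sqrt_pos.2 hs
  have hterm : ∀ i, x i * h i ≤ |x i| * l + √s / 2 * x i ^ 2 + (2 * √s)⁻¹ *
      (Real.exp (-l ^ 2) * (Real.exp (l * h i) + Real.exp (-l * h i))) := fun i => by
    set u := max (|h i| - l) 0
    have h1 : x i * h i ≤ |x i| * (l + u) := by
      calc x i * h i ≤ |x i| * |h i| := (le_abs_self _).trans_eq (abs_mul _ _)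
        _ ≤ |x i| * (l + u) := by
          gcongr
          linarith [le_max_left (|h i| - l) 0]
    have h2 : |x i| * u ≤ √s / 2 * x i ^ 2 + (2 * √s)⁻¹ * u ^ 2 := by
      rw [← sq_abs (x i)]
      have : √s / 2 * |x i| ^ 2 + (2 * √s)⁻¹ * u ^ 2 - |x i| * u
          = (2 * √s)⁻¹ * (√s * |x i| - u) ^ 2 := by
        field_simp
        ring
      have : 0 ≤ (2 * √s)⁻¹ * (√s * |x i| - u) ^ 2 := by positivity
      linarith
    have h3 := mul_le_mul_of_nonneg_left (sq_excess_le_exp hl hl0 (h i))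
      (show 0 ≤ (2 * √s)⁻¹ by positivity)
    linarith
  have hx2' : ∑ i, x i ^ 2 ≤ 1 := by
    rw [← EuclideanSpace.real_norm_sq_eq]
    exact pow_le_one₀ (norm_nonneg _) hx2
  calc inner ℝ x h = ∑ i, x i * h i := by
        simp [PiLp.inner_apply, mul_comm]
    _ ≤ _ := Finset.sum_le_sum fun i _ => hterm i
    _ = (∑ i, |x i|) * l + √s / 2 * ∑ i, x i ^ 2 + (2 * √s)⁻¹ *
          ∑ i, Real.exp (-l ^ 2) * (Real.exp (l * h i) + Real.exp (-l * h i)) := by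
        rw [Finset.sum_add_distrib, Finset.sum_add_distrib, Finset.sum_mul, Finset.mul_sum,
          Finset.mul_sum]
    _ ≤ _ := by
        gcongr
        exact mul_le_of_le_one_right (by positivity) hx2'

variable {n N : ℕ} {D : Matrix (Fin n) (Fin N) ℝ}

theorem unitEffAnalysisSparse_subset_closedBall (D : Matrix (Fin n) (Fin N) ℝ) (s : ℝ) :
    unitEffAnalysisSparse D s ⊆ Metric.closedBall 0 1 :=
  Set.inter_subset_right.trans Metric.sphere_subset_closedBall

theorem analysis_apply (D : Matrix (Fin n) (Fin N) ℝ) (g : EuclideanSpace ℝ (Fin n))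
    (i : Fin N) :
    Matrix.toEuclideanLin Dᵀ g i
      = inner ℝ (Matrix.toEuclideanLin D (EuclideanSpace.single i 1)) g := by
  rw [real_inner_comm, ← inner_toEuclideanLin_transpose, EuclideanSpace.inner_single_right]
  simp

theorem gaussianWidth_le_threshold (hD : IsTightFrame D) {s l : ℝ} (hs : 0 < s)
    (hl : 2 ≤ l ^ 2) (hl0 : 0 ≤ l) :
    gaussianWidth (unitEffAnalysisSparse D s) ≤
      √s * l + √s / 2 + (2 * √s)⁻¹ * (N * (2 * Real.exp (-l ^ 2 / 2))) := by
  set μ := stdGaussian (EuclideanSpace ℝ (Fin n))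
  set a : Fin N → EuclideanSpace ℝ (Fin n) := fun i =>
    Matrix.toEuclideanLin D (EuclideanSpace.single i 1)
  have ha : ∀ i, ‖a i‖ ≤ 1 := fun i =>
    (hD.norm_synthesis_le _).trans_eq (by simp)
  have hpt : ∀ g, supInner (unitEffAnalysisSparse D s) g ≤ √s * l + √s / 2 + (2 * √s)⁻¹ *
      ∑ i, Real.exp (-l ^ 2) *
        (Real.exp (l * inner ℝ (a i) g) + Real.exp (-l * inner ℝ (a i) g)) := fun g => by
    -- `Real.sSup_le` also covers an empty set, where the supremum is 0; this is why the bound must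
    -- be nonnegative.
    refine Real.sSup_le ?_ (by positivity)
    rintro _ ⟨f, hf, rfl⟩
    obtain ⟨hl1, hl2⟩ := (mem_unitEffAnalysisSparse_iff hD).1 hf
    have h := inner_le_threshold hs hl hl0 (Matrix.toEuclideanLin Dᵀ f)
      (Matrix.toEuclideanLin Dᵀ g) hl1 (by rw [hD.norm_analysis, hl2])
    rw [hD.inner_analysis] at h
    simpa only [analysis_apply] using h
  have hint : ∀ i, Integrable (fun g => Real.exp (-l ^ 2) *
      (Real.exp (l * inner ℝ (a i) g) + Real.exp (-l * inner ℝ (a i) g))) μ := fun i =>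
    ((integrable_exp_mul_inner_stdGaussian (a i) l).add
      (integrable_exp_mul_inner_stdGaussian (a i) (-l))).const_mul _
  have hval : ∀ i, ∫ g, Real.exp (-l ^ 2) *
      (Real.exp (l * inner ℝ (a i) g) + Real.exp (-l * inner ℝ (a i) g)) ∂μ
      ≤ 2 * Real.exp (-l ^ 2 / 2) := fun i => by
    rw [integral_const_mul, integral_add (integrable_exp_mul_inner_stdGaussian (a i) l)
      (integrable_exp_mul_inner_stdGaussian (a i) (-l)), integral_exp_mul_inner_stdGaussian,
      integral_exp_mul_inner_stdGaussian, neg_sq, ← two_mul]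
    have hle : Real.exp (‖a i‖ ^ 2 * l ^ 2 / 2) ≤ Real.exp (l ^ 2 / 2) := by
      gcongr
      exact mul_le_of_le_one_left (sq_nonneg l) (pow_le_one₀ (norm_nonneg _) (ha i))
    calc Real.exp (-l ^ 2) * (2 * Real.exp (‖a i‖ ^ 2 * l ^ 2 / 2))
        ≤ Real.exp (-l ^ 2) * (2 * Real.exp (l ^ 2 / 2)) := by gcongr
      _ = 2 * (Real.exp (-l ^ 2) * Real.exp (l ^ 2 / 2)) := by ring
      _ = _ := by
        rw [← Real.exp_add]
        ring_nf
  have hsumint := (integrable_finsetSum (μ := μ) Finset.univ fun i _ => hint i).const_mul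
    (2 * √s)⁻¹
  calc gaussianWidth (unitEffAnalysisSparse D s)
      ≤ ∫ g, (√s * l + √s / 2 + (2 * √s)⁻¹ * ∑ i, Real.exp (-l ^ 2) *
          (Real.exp (l * inner ℝ (a i) g) + Real.exp (-l * inner ℝ (a i) g))) ∂μ :=
        integral_mono (integrable_supInner (unitEffAnalysisSparse_subset_closedBall D s))
          ((integrable_const _).add hsumint) hpt
    _ = √s * l + √s / 2 + (2 * √s)⁻¹ * ∑ i, ∫ g, Real.exp (-l ^ 2) *
          (Real.exp (l * inner ℝ (a i) g) + Real.exp (-l * inner ℝ (a i) g)) ∂μ := by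
        rw [integral_add (integrable_const _) hsumint, integral_const_mul,
          integral_finsetSum _ fun i _ => hint i]
        simp
    _ ≤ _ := by
        gcongr
        refine (Finset.sum_le_card_nsmul _ _ _ fun i _ => hval i).trans_eq ?_
        simp

theorem gaussianWidth_unitEffAnalysisSparse_le (hD : IsTightFrame D) {s : ℝ} (hs : 0 < s)
    (hsN : s ≤ N) :
    gaussianWidth (unitEffAnalysisSparse D s)
      ≤ 4 * √(s * Real.log (Real.exp 1 * N / s)) := by
  have hN : (0 : ℝ) < N := hs.trans_le hsN
  have hs' : 0 < √s := Real.sqrt_pos.2 hs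
  have hpos : 0 < Real.exp 1 * N / s := by positivity
  set L := Real.log (Real.exp 1 * N / s)
  have hL : 1 ≤ L := by
    rw [Real.le_log_iff_exp_le hpos, le_div_iff₀ hs]
    gcongr
  have hl2 : √(2 * L) ^ 2 = 2 * L := Real.sq_sqrt (by positivity)
  -- The level l = √(2L) gives exp(−l²/2) = s/(eN); the requirement 2 ≤ l² is L ≥ 1, that is, s ≤ N.
  have h := gaussianWidth_le_threshold hD hs (by linarith) (Real.sqrt_nonneg (2 * L))
  have hexp : N * (2 * Real.exp (-√(2 * L) ^ 2 / 2)) ≤ s := by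
    rw [hl2, show -(2 * L) / 2 = -L by ring, Real.exp_neg, Real.exp_log hpos]
    have he : 2 ≤ Real.exp 1 := by linarith [Real.add_one_le_exp (1 : ℝ)]
    rw [show N * (2 * (Real.exp 1 * N / s)⁻¹) = s * (2 / Real.exp 1) by field_simp]
    exact mul_le_of_le_one_right hs.le ((div_le_one (Real.exp_pos 1)).2 he)
  have hlast : (2 * √s)⁻¹ * (N * (2 * Real.exp (-√(2 * L) ^ 2 / 2))) ≤ √s / 2 := by
    refine (mul_le_mul_of_nonneg_left hexp (by positivity)).trans_eq ?_
    nth_rewrite 2 [← Real.mul_self_sqrt hs.le]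
    field_simp
  have hroot : √(2 * L) ≤ 2 * √L := by
    rw [Real.sqrt_le_left (by positivity), mul_pow, Real.sq_sqrt (by positivity)]
    linarith
  have hone : 1 ≤ √L := Real.one_le_sqrt.2 hL
  rw [Real.sqrt_mul hs.le]
  -- The total is at most √s(l + 1) ≤ √s(2√L + √L), within the constant 4.
  nlinarith

end GaussianWidth

theorem mainTheorem9 :
    ∃ C : ℝ, 0 < C ∧
      ∀ (n N : ℕ) (D : Matrix (Fin n) (Fin N) ℝ), IsTightFrame D →
      ∀ s : ℝ, 0 < s →
        (s ≤ N →
          Integrable (supInner (unitEffAnalysisSparse D s))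
            (stdGaussian (EuclideanSpace ℝ (Fin n))) ∧
          gaussianWidth (unitEffAnalysisSparse D s)
            ≤ C * √(s * Real.log (Real.exp 1 * N / s))) ∧
        (∀ (ρ : ℝ≥0) (t : ℕ), 0 < ρ → t = ⌈4 * ((ρ : ℝ) ^ 2)⁻¹ * s⌉₊ → t ≤ N →
          (Metric.coveringNumber ρ (unitEffAnalysisSparse D s) : ℝ≥0∞)
            ≤ (N.choose t : ℝ≥0∞) * (1 + 8 / (ρ : ℝ≥0∞)) ^ t) := by
  refine ⟨4, by norm_num, fun n N D hD s hs => ⟨fun hsN => ⟨?_, ?_⟩, fun ρ t hρ ht htN => ?_⟩⟩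
  · exact integrable_supInner (unitEffAnalysisSparse_subset_closedBall D s)
  · exact gaussianWidth_unitEffAnalysisSparse_le hD hs hsN
  · exact coveringNumber_unitEffAnalysisSparse_le hD hs hρ (ht ▸ Nat.le_ceil _) htN
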